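/- **Setting.** Let $V$ be a finite set. A *directed tree on $V$ with a self-loop at its source $r$* is a directed graph $G=(V,E)$, $E\subseteq V\times V$, such that, self-loops disregarded, its underlying undirected graph is a tree (with no pair of vertices joined by edges in both directions) and $r$ is its only vertex without incoming edges, and such that $(r,r)$ is the only self-loop in $E$. Directed paths may use self-loops; the length of a path is its number of edges. - $V_\ell(G)$ is the set of vertices at *level* $\ell$, i.e. those whose shortest directed path from the source has length $\ell$. - An *equitrek* between $i,j\in V$ is a pair of directed paths of the same length from a common vertex, its *top*, to $i$ and to $j$ respectively. (In a directed tree with a self-loop at its source there is a unique shortest equitrek between any two vertices.) - For $n\ge 2$, $\mathcal M_G^{\le n}$ is the set of all $(T_2,\dots,T_n)$, with $T_m$ a real tensor of order $m$ on $\mathbb R^V$, for which there are a matrix $A\in\mathbb R^{V\times V}$ all of whose complex eigenvalues have absolute value less than $1$ and with $a_{ji}=0$ whenever $(i,j)\notin E$, and diagonal tensors $\Omega^{(2)},\dots,\Omega^{(n)}$ (with $\Omega^{(m)}$ of order $m$) such that, for all $2\le m\le n$, $$T_m=\sum_{k=0}^{\infty}\Omega^{(m)}\times_1 A^k\times_2\cdots\times_m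 A^k,\qquad\text{i.e.}\qquad (T_m)_{j_1\cdots j_m}=\sum_{k\ge 0}\ \sum_{i_1,\dots,i_m\in V}\Omega^{(m)}_{i_1\cdots i_m}(A^k)_{j_1i_1}\cdots(A^k)_{j_mi_m}.$$ - $\mathcal I^{\le n}(G)$ is the ideal of all real polynomials in the entries of $T_2,\dots,T_n$ that vanish on $\mathcal M_G^{\le n}$. **Theorem.** Let $n\ge 3$, and let $G$ and $H$ be two directed trees on the same finite vertex set $V$, each with a self-loop at its source and no other self-loop. Then $\mathcal I^{\le n}(G)=\mathcal I^{\le n}(H)$ if and only if 1. $V_\ell(G)=V_\ell(H)$ for all $\ell\ge 0$, and 2. for each pair of vertices $i,j\in V$, the top of the shortest equitrek between $i$ and $j$ is the same in $G$ and in $H$. -/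

import Mathlib

namespace DiscreteLyapunov

/-! ### Directed trees with a self-loop at the source -/

/-- `G` is a directed tree with source `r` that has a self-loop at `r` and no other self-loop.
Self-loops are disregarded for the tree and source conditions: the underlying undirected graph
(`u ~ v` iff `u ≠ v` and `u → v` or `v → u`) is a tree, no two distinct vertices are joined by
edges in both directions, and `r` is the one and only vertex without an incoming edge. -/
structure IsDirectedTree {V : Type*} (G : Digraph V) (r : V) : Prop where
  isTree : G.toSimpleGraphInclusive.IsTree
  asymm : ∀ u v : V, u ≠ v → G.Adj u v → ¬ G.Adj v u
  source_iff : ∀ v : V, (∀ u : V, u ≠ v → ¬ G.Adj u v) ↔ v = r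
  loop_iff : ∀ v : V, G.Adj v v ↔ v = r

/-! ### Paths, levels and equitreks -/

/-- `DirPath G l u v` is the type of directed paths of length `l` (number of edges) from `u`
to `v` in `G`; edges, in particular self-loops, may be used repeatedly. -/
inductive DirPath {V : Type*} (G : Digraph V) : ℕ → V → V → Type _
  | nil (u : V) : DirPath G 0 u u
  | cons {l : ℕ} {u v w : V} (P : DirPath G l u v) (h : G.Adj v w) : DirPath G (l + 1) u w

/-- The set of vertices at level `l` of a directed tree with source `r`: those for which the
shortest directed path from `r` has length `l`. -/
def levelSet {V : Type*} (G : Digraph V) (r : V) (l : ℕ) : Set V :=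
  {v | IsLeast {d : ℕ | Nonempty (DirPath G d r v)} l}

/-- An equitrek between `i` and `j`: two directed paths of the same length from a common vertex,
the top, to `i` and to `j`. -/
structure Equitrek {V : Type*} (G : Digraph V) (i j : V) where
  top : V
  length : ℕ
  left : DirPath G length top i
  right : DirPath G length top j

/-- No equitrek between `i` and `j` is shorter than `τ`. -/
def Equitrek.IsShortest {V : Type*} {G : Digraph V} {i j : V} (τ : Equitrek G i j) : Prop :=
  ∀ τ' : Equitrek G i j, τ.length ≤ τ'.length

/-- `t` is the top of a shortest equitrek between `i` and `j`. In a directed tree with a self-loop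
at the source there is exactly one shortest equitrek between any two vertices. -/
def IsTopOfShortestEquitrek {V : Type*} (G : Digraph V) (i j t : V) : Prop :=
  ∃ τ : Equitrek G i j, τ.IsShortest ∧ τ.top = t

/-! ### The discrete Lyapunov cumulant model and its ideal -/

/-- Tensors of order `m` on `ℝ^V`. -/
abbrev Tensor (V : Type*) (m : ℕ) : Type _ := (Fin m → V) → ℝ

/-- A tensor is diagonal if its entries vanish at all non-constant index tuples. Such a tensor
is symmetric. -/
def Tensor.IsDiagonal {V : Type*} {m : ℕ} (Ω : Tensor V m) : Prop :=
  ∀ i : Fin m → V, (∃ a b : Fin m, i a ≠ i b) → Ω i = 0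

/-- The Tucker product `Ω ×₁ B ×₂ B ⋯ ×ₘ B` of a tensor with the matrix `B` along every mode. -/
def Tensor.tucker {V : Type*} [Fintype V] {m : ℕ} (Ω : Tensor V m) (B : Matrix V V ℝ) :
    Tensor V m :=
  fun j => ∑ i : Fin m → V, Ω i * ∏ k : Fin m, B (j k) (i k)

/-- All complex eigenvalues of `A` have absolute value less than one. -/
def IsSchurStable {V : Type*} [Fintype V] [DecidableEq V] (A : Matrix V V ℝ) : Prop :=
  ∀ z ∈ spectrum ℂ (A.map (Complex.ofReal : ℝ → ℂ)), ‖z‖ < 1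

/-- The sparsity pattern `ℝ^E`: the entry `A j i` vanishes unless `i → j` is an edge. -/
def HasSparsity {V : Type*} (G : Digraph V) (A : Matrix V V ℝ) : Prop :=
  ∀ i j : V, ¬ G.Adj i j → A j i = 0

/-- The orders `2, …, n`. -/
abbrev Order (n : ℕ) : Type := {m : ℕ // 2 ≤ m ∧ m ≤ n}

/-- Positions of the entries of a sequence of tensors `(T_2, …, T_n)` on `ℝ^V`. -/
abbrev EntryIndex (V : Type*) (n : ℕ) : Type _ := Σ m : Order n, Fin m.1 → V

/-- The `n`th-order discrete Lyapunov cumulant model of `G`: all `(T_2, …, T_n)` with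
`T_m = ∑_{k ≥ 0} Ω_m ×₁ A^k ⋯ ×ₘ A^k` for `2 ≤ m ≤ n`, where `A` is Schur stable with the
sparsity pattern of `G`, the same for all `m`, and every `Ω_m` is diagonal. A sequence is
recorded as the family of all its entries. -/
def model {V : Type*} [Fintype V] [DecidableEq V] (n : ℕ) (G : Digraph V) :
    Set (EntryIndex V n → ℝ) :=
  {T | ∃ (A : Matrix V V ℝ) (Ω : ∀ m : Order n, Tensor V m.1),
    HasSparsity G A ∧ IsSchurStable A ∧ (∀ m, (Ω m).IsDiagonal) ∧
    ∀ (m : Order n) (j : Fin m.1 → V),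
      HasSum (fun k : ℕ => (Ω m).tucker (A ^ k) j) (T ⟨m, j⟩)}

/-- The `n`th-order cumulant ideal of `G`: the real polynomials in the entries of `T_2, …, T_n`
that vanish on the model. -/
noncomputable def cumulantIdeal {V : Type*} [Fintype V] [DecidableEq V] (n : ℕ)
    (G : Digraph V) : Ideal (MvPolynomial (EntryIndex V n) ℝ) :=
  MvPolynomial.vanishingIdeal ℝ (model n G)

end DiscreteLyapunov

namespace DiscreteLyapunov

/-! ### Parent maps -/

/-! In such a tree every vertex `v` has exactly one predecessor `p v`, with `p r = r` through the
self-loop. So `A` has at most one nonzero entry per row, and the entry of `T_m` at `j` is a series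
over those `k` for which `p^[k]` sends all indices to the same vertex. If no edge weight is zero,
the weights can be written `a v = ρ * ψ v / ψ (p v)` with `ρ = a r`. Writing the noise as `ψ t ^ m *
(c t - ρ ^ m * c (p t))` makes the series telescope to the monomial `∏ ψ (j s) * ρ ^ (m * τ) * c
(top)`, where `τ` is the first meeting time of the indices and `top` their meeting point
(`hasSum_trekTerm_gauge`).

These points are dense in the model, so the ideal depends on the tree only through meeting times and
tops. A family meets when its slowest pair with a base member does, and a pair meets after the
larger of its depths minus the depth of its top. Hence levels and tops determine the ideal.

Conversely, a covariance at `(i, j)` and the third cumulants at `(i, i, j)` and `(i, j, j)` involve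
the same time and top, with factors `ρ ^ (2 * τ)` and `ρ ^ (3 * τ)`. Cancelling `ψ` and `ρ` between
them leaves a test for the top; cancelling `ψ` and `c` leaves `ρ` to the power of the depth, which
yields the ratios of depths. A vertex of depth one then fixes the scale. -/

/-- `p` sends every vertex of `G` to its unique predecessor, and its iterates reach `r`. -/
structure IsParentMap {V : Type*} (G : Digraph V) (r : V) (p : V → V) : Prop where
  adj_iff : ∀ u v : V, G.Adj u v ↔ p v = u
  root : p r = r
  reach : ∀ v : V, ∃ k : ℕ, p^[k] v = r

theorem IsDirectedTree.exists_isParentMap {V : Type*} [Fintype V] {G : Digraph V} {r : V}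
    (hG : IsDirectedTree G r) : ∃ p : V → V, IsParentMap G r p := by
  classical
  have hpred : ∀ v : V, v ≠ r → ∃ u, u ≠ v ∧ G.Adj u v := by
    intro v hv
    by_contra! h
    exact hv ((hG.source_iff v).1 h)
  have hmap : ∀ v : V, ∃ u, G.Adj u v ∧ (v ≠ r → u ≠ v) ∧ (v = r → u = r) := by
    intro v
    by_cases hv : v = r
    · exact ⟨v, (hG.loop_iff v).2 hv, fun h => absurd hv h, fun h => h⟩
    · obtain ⟨u, h1, h2⟩ := hpred v hv
      exact ⟨u, h2, fun _ => h1, fun h => absurd h hv⟩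
  choose p hp hne hroot using hmap
  set T := G.toSimpleGraphInclusive with hT
  have hadj : ∀ u v, T.Adj u v ↔ u ≠ v ∧ (G.Adj u v ∨ G.Adj v u) := fun u v => Iff.rfl
  have hr : p r = r := hroot r rfl
  have hmem : ∀ v ∈ Finset.univ.erase r, s(p v, v) ∈ T.edgeFinset := by
    intro v hv
    have hv' : v ≠ r := (Finset.mem_erase.1 hv).1
    rw [SimpleGraph.mem_edgeFinset, SimpleGraph.mem_edgeSet, hadj]
    exact ⟨hne v hv', Or.inl (hp v)⟩
  have hinj : Set.InjOn (fun v => s(p v, v)) (Finset.univ.erase r : Finset V) := by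
    intro v hv w hw h
    have hv' : v ≠ r := (Finset.mem_erase.1 hv).1
    rcases Sym2.eq_iff.1 h with h | h
    · exact h.2
    · exfalso
      have h1 := hp v
      have h2 := hp w
      rw [h.1] at h1
      rw [← h.2] at h2
      exact hG.asymm v w (by rw [← h.1]; exact (hne v hv').symm) h2 h1
  -- A tree has one edge fewer than vertices, so the distinct edges from `p v` to `v`, for `v ≠ r`,
  -- are all of them. This is what makes predecessors unique.
  have hcard : T.edgeFinset.card ≤ (Finset.univ.erase r).card := by
    have : T.edgeFinset.card + 1 = Fintype.card V := hG.isTree.card_edgeFinset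
    rw [Finset.card_erase_of_mem (Finset.mem_univ r), Finset.card_univ]
    omega
  have hsurj := Finset.surjOn_of_injOn_of_card_le (fun v => s(p v, v)) hmem hinj hcard
  have hadj' : ∀ u v : V, G.Adj u v ↔ p v = u := by
    intro u v
    refine ⟨fun h => ?_, fun h => h ▸ hp v⟩
    by_cases huv : u = v
    · subst huv
      rw [(hG.loop_iff u).1 h, hr]
    · have he : s(u, v) ∈ (T.edgeFinset : Set (Sym2 V)) := by
        rw [Finset.mem_coe, SimpleGraph.mem_edgeFinset, SimpleGraph.mem_edgeSet, hadj]
        exact ⟨huv, Or.inl h⟩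
      obtain ⟨w, -, hw⟩ := hsurj he
      rcases Sym2.eq_iff.1 hw with hw | hw
      · rw [← hw.2, hw.1]
      · have := hp w
        rw [hw.1, hw.2] at this
        exact absurd this (hG.asymm u v huv h)
  refine ⟨p, hadj', hr, ?_⟩
  -- Reaching `r` passes along undirected edges in both directions, hence along a walk that starts
  -- at `r`.
  have hstep : ∀ u v : V, T.Adj u v → (∃ k : ℕ, p^[k] u = r) → ∃ k : ℕ, p^[k] v = r := by
    rintro u v huv ⟨k, hk⟩
    rcases ((hadj u v).1 huv).2 with h | h
    · exact ⟨k + 1, by rw [Function.iterate_succ_apply, (hadj' u v).1 h, hk]⟩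
    · have hpu := (hadj' v u).1 h
      refine ⟨k, ?_⟩
      rw [← hpu, ← Function.iterate_succ_apply, Function.iterate_succ_apply', hk, hr]
  intro v
  obtain ⟨w⟩ := hG.isTree.connected.preconnected r v
  have : ∀ {a b : V}, T.Walk a b → (∃ k : ℕ, p^[k] a = r) → ∃ k : ℕ, p^[k] b = r := by
    intro a b w
    induction w with
    | nil => exact id
    | cons h _ ih => exact fun h' => ih (hstep _ _ h h')
  exact this w ⟨0, rfl⟩

theorem IsParentMap.nonempty_dirPath_iff {V : Type*} {G : Digraph V} {r : V} {p : V → V}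
    (hp : IsParentMap G r p) (l : ℕ) (u v : V) : Nonempty (DirPath G l u v) ↔ p^[l] v = u := by
  constructor
  · rintro ⟨P⟩
    induction P with
    | nil => rfl
    | cons P h ih => rw [Function.iterate_succ_apply, (hp.adj_iff _ _).1 h, ih]
  · intro h
    induction l generalizing v with
    | zero => cases h; exact ⟨.nil _⟩
    | succ l ih =>
      obtain ⟨P⟩ := ih (p v) h
      exact ⟨P.cons ((hp.adj_iff _ _).2 rfl)⟩

/-- The number of steps that the iterates of `p` need from `v` to `r`. -/
noncomputable def depth {V : Type*} (p : V → V) (r v : V) : ℕ := sInf {k | p^[k] v = r}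

/-- The first time at which the iterates of `p` from `i` and from `j` agree. -/
noncomputable def pairTime {V : Type*} (p : V → V) (i j : V) : ℕ := sInf {k | p^[k] i = p^[k] j}

/-- The vertex at which the iterates of `p` from `i` and from `j` meet for the first time. -/
noncomputable def pairTop {V : Type*} (p : V → V) (i j : V) : V := p^[pairTime p i j] i

section ParentMap

variable {V : Type*} {G : Digraph V} {r : V} {p : V → V}

/-! ### Depths, meeting times and tops -/

theorem iterate_eq_of_le {i j : V} {k l : ℕ} (h : p^[k] i = p^[k] j) (hkl : k ≤ l) :
    p^[l] i = p^[l] j := by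
  obtain ⟨d, rfl⟩ := Nat.exists_eq_add_of_le' hkl
  rw [Function.iterate_add_apply, Function.iterate_add_apply, h]

theorem IsParentMap.iterate_root (hp : IsParentMap G r p) (k : ℕ) : p^[k] r = r :=
  Function.iterate_fixed hp.root k

theorem IsParentMap.iterate_depth (hp : IsParentMap G r p) (v : V) : p^[depth p r v] v = r :=
  Nat.sInf_mem (s := {k | p^[k] v = r}) (hp.reach v)

theorem IsParentMap.depth_le_iff (hp : IsParentMap G r p) (v : V) (k : ℕ) :
    depth p r v ≤ k ↔ p^[k] v = r := by
  constructor
  · intro h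
    have := iterate_eq_of_le (p := p) (i := v) (j := r) (k := depth p r v)
      (by rw [hp.iterate_depth, hp.iterate_root]) h
    rwa [hp.iterate_root] at this
  · exact fun h => Nat.sInf_le h

theorem IsParentMap.depth_root (hp : IsParentMap G r p) : depth p r r = 0 :=
  Nat.le_zero.1 ((hp.depth_le_iff r 0).2 rfl)

theorem IsParentMap.depth_iterate (hp : IsParentMap G r p) (v : V) (k : ℕ) :
    depth p r (p^[k] v) = depth p r v - k := by
  refine eq_of_forall_ge_iff fun l => ?_
  rw [hp.depth_le_iff, ← Function.iterate_add_apply, ← hp.depth_le_iff]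
  omega

theorem IsParentMap.pairTime_mem (hp : IsParentMap G r p) (i j : V) :
    p^[pairTime p i j] i = p^[pairTime p i j] j := by
  refine Nat.sInf_mem (s := {k | p^[k] i = p^[k] j}) ⟨max (depth p r i) (depth p r j), ?_⟩
  rw [Set.mem_ofPred_eq, (hp.depth_le_iff i _).1 (le_max_left _ _),
    (hp.depth_le_iff j _).1 (le_max_right _ _)]

theorem IsParentMap.pairTime_le_iff (hp : IsParentMap G r p) (i j : V) (k : ℕ) :
    pairTime p i j ≤ k ↔ p^[k] i = p^[k] j :=
  ⟨fun h => iterate_eq_of_le (hp.pairTime_mem i j) h, fun h => Nat.sInf_le h⟩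

theorem IsParentMap.pairTime_self (hp : IsParentMap G r p) (i : V) : pairTime p i i = 0 :=
  Nat.le_zero.1 ((hp.pairTime_le_iff i i 0).2 rfl)

theorem IsParentMap.pairTop_self (hp : IsParentMap G r p) (i : V) : pairTop p i i = i := by
  rw [pairTop, hp.pairTime_self]; rfl

theorem IsParentMap.pairTime_root (hp : IsParentMap G r p) (i : V) :
    pairTime p i r = depth p r i :=
  eq_of_forall_ge_iff fun k => by rw [hp.pairTime_le_iff, hp.depth_le_iff, hp.iterate_root]

theorem IsParentMap.pairTop_root (hp : IsParentMap G r p) (i : V) : pairTop p i r = r := by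
  rw [pairTop, hp.pairTime_mem, hp.iterate_root]

theorem IsParentMap.root_pairTop (hp : IsParentMap G r p) (i : V) : pairTop p r i = r := by
  rw [pairTop, hp.iterate_root]

/-- Each step lowers the depth by one until the root is reached. Vertices that meet away from the
root have equal depth; those that meet only at the root do so when the deeper one arrives. -/
theorem IsParentMap.pairTime_eq (hp : IsParentMap G r p) (i j : V) :
    pairTime p i j = max (depth p r i) (depth p r j) - depth p r (pairTop p i j) := by
  have h1 := hp.depth_iterate i (pairTime p i j)
  have h2 := hp.depth_iterate j (pairTime p i j)
  rw [← hp.pairTime_mem] at h2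
  have h3 : pairTime p i j ≤ max (depth p r i) (depth p r j) := by
    rw [hp.pairTime_le_iff, (hp.depth_le_iff i _).1 (le_max_left _ _),
      (hp.depth_le_iff j _).1 (le_max_right _ _)]
  rw [pairTop]
  omega

theorem IsParentMap.mem_levelSet_iff (hp : IsParentMap G r p) (l : ℕ) (v : V) :
    v ∈ levelSet G r l ↔ depth p r v = l := by
  have h : IsLeast {d : ℕ | Nonempty (DirPath G d r v)} (depth p r v) := by
    simp only [hp.nonempty_dirPath_iff]
    exact ⟨hp.iterate_depth v, fun k hk => (hp.depth_le_iff v k).2 hk⟩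
  exact ⟨fun hl => h.unique hl, fun hl => hl ▸ h⟩

theorem IsParentMap.levelSet_eq_iff {H : Digraph V} {s : V} {q : V → V}
    (hp : IsParentMap G r p) (hq : IsParentMap H s q) :
    (∀ l, levelSet G r l = levelSet H s l) ↔ ∀ v, depth p r v = depth q s v := by
  constructor
  · intro h v
    exact ((hq.mem_levelSet_iff _ _).1 (h _ ▸ (hp.mem_levelSet_iff _ v).2 rfl)).symm
  · intro h l
    ext v
    rw [hp.mem_levelSet_iff, hq.mem_levelSet_iff, h]

theorem IsParentMap.isTopOfShortestEquitrek_iff (hp : IsParentMap G r p) (i j t : V) :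
    IsTopOfShortestEquitrek G i j t ↔ pairTop p i j = t := by
  have hlen : ∀ τ : Equitrek G i j, p^[τ.length] i = τ.top ∧ p^[τ.length] j = τ.top :=
    fun τ => ⟨(hp.nonempty_dirPath_iff _ _ _).1 ⟨τ.left⟩,
      (hp.nonempty_dirPath_iff _ _ _).1 ⟨τ.right⟩⟩
  have hle : ∀ τ : Equitrek G i j, pairTime p i j ≤ τ.length := fun τ =>
    (hp.pairTime_le_iff i j _).2 ((hlen τ).1.trans (hlen τ).2.symm)
  obtain ⟨P⟩ := (hp.nonempty_dirPath_iff (pairTime p i j) (pairTop p i j) i).2 rfl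
  obtain ⟨Q⟩ := (hp.nonempty_dirPath_iff (pairTime p i j) (pairTop p i j) j).2
    (hp.pairTime_mem i j).symm
  constructor
  · rintro ⟨τ, hτ, rfl⟩
    have : τ.length = pairTime p i j := le_antisymm (hτ ⟨_, _, P, Q⟩) (hle τ)
    rw [pairTop, ← this, (hlen τ).1]
  · rintro rfl
    exact ⟨⟨_, _, P, Q⟩, fun τ => hle τ, rfl⟩

theorem IsParentMap.top_eq_iff {H : Digraph V} {s : V} {q : V → V}
    (hp : IsParentMap G r p) (hq : IsParentMap H s q) :
    (∀ i j t, IsTopOfShortestEquitrek G i j t ↔ IsTopOfShortestEquitrek H i j t) ↔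
      ∀ i j, pairTop p i j = pairTop q i j := by
  simp only [hp.isTopOfShortestEquitrek_iff, hq.isTopOfShortestEquitrek_iff]
  exact ⟨fun h i j => ((h i j _).1 rfl).symm, fun h i j t => by rw [h]⟩

end ParentMap

/-- The first time at which the iterates of `p` from all members of the family `x` agree, measured
from the base point `o` of the index type. -/
noncomputable def familyTime {V ι : Type*} [Fintype ι] (p : V → V) (o : ι) (x : ι → V) : ℕ :=
  Finset.univ.sup fun s => pairTime p (x o) (x s)

/-- The vertex at which the iterates of `p` from the members of `x` meet for the first time. -/
noncomputable def familyTop {V ι : Type*} [Fintype ι] (p : V → V) (o : ι) (x : ι → V) : V :=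
  p^[familyTime p o x] (x o)

theorem IsParentMap.familyTime_le_iff {V ι : Type*} [Fintype ι] {G : Digraph V} {r : V} {p : V → V}
    (hp : IsParentMap G r p) (o : ι) (x : ι → V) (k : ℕ) :
    familyTime p o x ≤ k ↔ ∀ s, p^[k] (x s) = p^[k] (x o) := by
  simp only [familyTime, Finset.sup_le_iff, Finset.mem_univ, true_imp_iff, hp.pairTime_le_iff]
  exact forall_congr' fun s => eq_comm

/-- The maximum defining the family time is attained at some pair, so the top of the family is the
top of that pair. -/
theorem familyTop_congr {V ι : Type*} [Fintype ι] {p q : V → V}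
    (ht : ∀ i j, pairTime p i j = pairTime q i j) (h : ∀ i j, pairTop p i j = pairTop q i j)
    (o : ι) (x : ι → V) : familyTop p o x = familyTop q o x := by
  obtain ⟨s, -, hs⟩ := Finset.exists_mem_eq_sup Finset.univ ⟨o, Finset.mem_univ o⟩
    fun s => pairTime p (x o) (x s)
  have h1 : familyTime p o x = pairTime p (x o) (x s) := hs
  have h2 : familyTime q o x = pairTime q (x o) (x s) := by
    rw [← ht, ← h1]
    simp only [familyTime, ht]
  rw [familyTop, familyTop, h1, h2]
  exact h _ _


/-! ### The model of a parent map -/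

section Model

variable {V : Type*} {G : Digraph V} {r : V} {p : V → V}

/-- The matrix whose only nonzero entries are `a v` in row `v` and column `p v`. -/
def parentMatrix [DecidableEq V] (p : V → V) (a : V → ℝ) : Matrix V V ℝ :=
  Matrix.of fun j i => if p j = i then a j else 0

/-- The product of the weights `a` along the first `k` steps of the iteration of `p` from `v`. -/
def pathWeight (p : V → V) (a : V → ℝ) (k : ℕ) (v : V) : ℝ := ∏ s ∈ Finset.range k, a (p^[s] v)

theorem pathWeight_add (p : V → V) (a : V → ℝ) (k l : ℕ) (v : V) :
    pathWeight p a (k + l) v = pathWeight p a k v * pathWeight p a l (p^[k] v) := by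
  simp only [pathWeight, Finset.prod_range_add]
  congr 1
  exact Finset.prod_congr rfl fun s _ => by rw [add_comm k, Function.iterate_add_apply]

theorem pathWeight_succ' (p : V → V) (a : V → ℝ) (k : ℕ) (v : V) :
    pathWeight p a (k + 1) v = a v * pathWeight p a k (p v) := by
  rw [add_comm, pathWeight_add]
  simp [pathWeight]

theorem IsParentMap.pathWeight_root (hp : IsParentMap G r p) (a : V → ℝ) (k : ℕ) :
    pathWeight p a k r = a r ^ k := by
  simp [pathWeight, hp.iterate_root]

theorem pathWeight_gauge (p : V → V) {ρ : ℝ} {ψ : V → ℝ} (hψ : ∀ v, ψ v ≠ 0) (k : ℕ) (v : V) :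
    pathWeight p (fun v => ρ * ψ v / ψ (p v)) k v = ρ ^ k * ψ v / ψ (p^[k] v) := by
  induction k generalizing v with
  | zero => simp [pathWeight, hψ v]
  | succ k ih =>
    rw [pathWeight_succ', ih, ← Function.iterate_succ_apply]
    have := hψ (p v)
    have := hψ (p^[k + 1] v)
    field_simp
    ring

/-! ### Powers and spectrum of the sparse matrices -/

theorem IsParentMap.hasSparsity_iff [DecidableEq V] (hp : IsParentMap G r p) (A : Matrix V V ℝ) :
    HasSparsity G A ↔ ∃ a, A = parentMatrix p a := by
  constructor
  · intro h
    refine ⟨fun v => A v (p v), ?_⟩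
    ext j i
    by_cases hji : p j = i
    · simp [parentMatrix, hji]
    · simpa [parentMatrix, hji] using h i j (by rwa [hp.adj_iff])
  · rintro ⟨a, rfl⟩ i j h
    rw [hp.adj_iff] at h
    simp [parentMatrix, h]

theorem parentMatrix_pow_apply [Fintype V] [DecidableEq V] (p : V → V) (a : V → ℝ) (k : ℕ)
    (j i : V) : (parentMatrix p a ^ k) j i = if p^[k] j = i then pathWeight p a k j else 0 := by
  induction k generalizing j with
  | zero =>
    by_cases h : j = i <;> simp [h, pathWeight]
  | succ k ih =>
    rw [pow_succ', Matrix.mul_apply, Finset.sum_eq_single (p j)]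
    · rw [ih, pathWeight_succ', Function.iterate_succ_apply]
      simp [parentMatrix]
    · intro x _ hx
      simp [parentMatrix, hx.symm]
    · exact fun h => absurd (Finset.mem_univ _) h

theorem IsParentMap.exists_iterate_eq_root [Finite V] (hp : IsParentMap G r p) :
    ∃ L : ℕ, ∀ v, p^[L] v = r := by
  cases nonempty_fintype V
  exact ⟨Finset.univ.sup (depth p r), fun v =>
    (hp.depth_le_iff v _).1 (Finset.le_sup (Finset.mem_univ v))⟩

theorem IsParentMap.isSchurStable_iff [Fintype V] [DecidableEq V] (hp : IsParentMap G r p)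
    (a : V → ℝ) : IsSchurStable (parentMatrix p a) ↔ |a r| < 1 := by
  set B : Matrix V V ℂ := (parentMatrix p a).map (Complex.ofReal : ℝ → ℂ) with hB
  have hBapp : ∀ j i, B j i = if p j = i then (a j : ℂ) else 0 := by
    intro j i
    simp only [hB, parentMatrix, Matrix.map_apply, Matrix.of_apply]
    split_ifs <;> simp
  have hspec : ∀ z : ℂ, z ∈ spectrum ℂ B ↔ (algebraMap ℂ (Matrix V V ℂ) z - B).det = 0 := by
    intro z
    rw [spectrum.mem_iff, Matrix.isUnit_iff_isUnit_det, isUnit_iff_ne_zero, not_not]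
  constructor
  · intro h
    -- The only entry in row `r` is `a r` on the diagonal.
    have hz : (a r : ℂ) ∈ spectrum ℂ B := by
      rw [hspec]
      refine Matrix.det_eq_zero_of_row_eq_zero r fun i => ?_
      rw [Matrix.sub_apply, hBapp, hp.root, Matrix.algebraMap_matrix_apply]
      by_cases hi : r = i <;> simp [hi]
    simpa using h _ hz
  · intro h z hz
    rw [hspec, ← Matrix.exists_mulVec_eq_zero_iff] at hz
    obtain ⟨v, hv, hv0⟩ := hz
    have hstep : ∀ j, z * v j = a j * v (p j) := by
      intro j
      have := congrFun hv0 j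
      rw [Matrix.sub_mulVec, Pi.sub_apply, Algebra.algebraMap_eq_smul_one, Matrix.smul_mulVec,
        Matrix.one_mulVec, Pi.smul_apply, smul_eq_mul, Pi.zero_apply, sub_eq_zero] at this
      rw [this]
      simp [Matrix.mulVec, dotProduct, hBapp]
    have hiter : ∀ k j, z ^ k * v j = (pathWeight p a k j : ℂ) * v (p^[k] j) := by
      intro k
      induction k with
      | zero => intro j; simp [pathWeight]
      | succ k ih =>
        intro j
        rw [pow_succ, mul_assoc, hstep, mul_left_comm, ih, pathWeight_succ',
          Function.iterate_succ_apply]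
        push_cast
        ring
    -- An eigenvector vanishing at the root is killed by `z ^ L`, so `z = 0`; otherwise its equation
    -- at the root gives `z = a r`.
    by_cases hvr : v r = 0
    · obtain ⟨L, hL⟩ := hp.exists_iterate_eq_root
      obtain ⟨j, hj⟩ := Function.ne_iff.1 hv
      have h0 := hiter L j
      rw [hL, hvr, mul_zero] at h0
      have : z = 0 := eq_zero_of_pow_eq_zero ((mul_eq_zero.1 h0).resolve_right hj)
      simp [this]
    · have := hstep r
      rw [hp.root] at this
      rw [mul_right_cancel₀ hvr this]
      simpa using h

/-- The sum over the diagonal that a Tucker product with a diagonal tensor reduces to. -/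
theorem Tensor.IsDiagonal.tucker_apply [Fintype V] {m : ℕ} {Ω : Tensor V m} (hΩ : Ω.IsDiagonal)
    (o : Fin m) (B : Matrix V V ℝ) (j : Fin m → V) :
    Ω.tucker B j = ∑ t : V, Ω (fun _ => t) * ∏ s, B (j s) t := by
  classical
  symm
  refine Finset.sum_of_injOn (fun t _ => t) (fun t _ t' _ h => congrFun h o) (by simp) ?_ (by simp)
  intro i _ hi
  rw [hΩ i, zero_mul]
  by_contra! h
  exact hi ⟨i o, by simp, funext fun s => h o s⟩

/-- The contribution of the paths of length `k` to the entry at `j` of the cumulant tensor. -/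
noncomputable def trekTerm {m : ℕ} (p : V → V) (a ω : V → ℝ) (o : Fin m) (j : Fin m → V)
    (k : ℕ) : ℝ :=
  open Classical in
  if ∀ s, p^[k] (j s) = p^[k] (j o) then ω (p^[k] (j o)) * ∏ s, pathWeight p a k (j s) else 0

theorem Tensor.IsDiagonal.tucker_parentMatrix_pow [Fintype V] [DecidableEq V] {m : ℕ}
    {Ω : Tensor V m} (hΩ : Ω.IsDiagonal) (o : Fin m) (p : V → V) (a : V → ℝ) (j : Fin m → V)
    (k : ℕ) :
    Ω.tucker (parentMatrix p a ^ k) j = trekTerm p a (fun t => Ω fun _ => t) o j k := by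
  rw [hΩ.tucker_apply o, Finset.sum_eq_single (p^[k] (j o))]
  · simp only [parentMatrix_pow_apply, trekTerm]
    split_ifs with h
    · simp [h]
    · push Not at h
      obtain ⟨s, hs⟩ := h
      rw [Finset.prod_eq_zero (Finset.mem_univ s) (if_neg hs), mul_zero]
  · intro t _ ht
    rw [Finset.prod_eq_zero (Finset.mem_univ o), mul_zero]
    rw [parentMatrix_pow_apply, if_neg ht.symm]
  · exact fun h => absurd (Finset.mem_univ _) h

/-- The first index, as a base point. -/
def Order.base {n : ℕ} (m : Order n) : Fin m.1 := ⟨0, by have := m.2.1; omega⟩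

theorem IsParentMap.mem_model_iff [Fintype V] [DecidableEq V] {n : ℕ} (hp : IsParentMap G r p)
    (T : EntryIndex V n → ℝ) :
    T ∈ model n G ↔ ∃ (a : V → ℝ) (ω : Order n → V → ℝ), |a r| < 1 ∧
      ∀ (m : Order n) (j : Fin m.1 → V),
        HasSum (trekTerm p a (ω m) m.base j) (T ⟨m, j⟩) := by
  constructor
  · rintro ⟨A, Ω, hA, hS, hΩ, hT⟩
    obtain ⟨a, rfl⟩ := (hp.hasSparsity_iff A).1 hA
    refine ⟨a, fun m t => Ω m fun _ => t, (hp.isSchurStable_iff a).1 hS, fun m j => ?_⟩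
    simpa only [(hΩ m).tucker_parentMatrix_pow m.base] using hT m j
  · rintro ⟨a, ω, ha, hT⟩
    classical
    let Ω : ∀ m : Order n, Tensor V m.1 := fun m i =>
      if ∀ s, i s = i m.base then ω m (i m.base) else 0
    have hΩ : ∀ m, (Ω m).IsDiagonal := by
      rintro m i ⟨s, s', h⟩
      exact if_neg fun h' => h ((h' s).trans (h' s').symm)
    refine ⟨parentMatrix p a, Ω, (hp.hasSparsity_iff _).2 ⟨a, rfl⟩, (hp.isSchurStable_iff a).2 ha,
      hΩ, fun m j => ?_⟩
    simp only [(hΩ m).tucker_parentMatrix_pow m.base]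
    convert hT m j using 2
    simp [Ω]

/-- The sum of `trekTerm`, as a finite sum and a geometric tail. -/
theorem IsParentMap.hasSum_trekTerm (hp : IsParentMap G r p) {L : ℕ} (hL : ∀ v, p^[L] v = r)
    {m : ℕ} (hm : m ≠ 0) {a : V → ℝ} (ha : |a r| < 1) (ω : V → ℝ) (o : Fin m) (j : Fin m → V) :
    HasSum (trekTerm p a ω o j) (∑ k ∈ Finset.range L, trekTerm p a ω o j k +
      ω r * (∏ s, pathWeight p a L (j s)) * (1 - a r ^ m)⁻¹) := by
  have hterm : ∀ k, trekTerm p a ω o j (k + L) =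
      ω r * (∏ s, pathWeight p a L (j s)) * (a r ^ m) ^ k := by
    intro k
    have h : ∀ v, p^[k + L] v = r := fun v => by
      rw [Function.iterate_add_apply, hL, hp.iterate_root]
    simp only [trekTerm, h, implies_true, if_true]
    simp only [add_comm k, pathWeight_add, hL, hp.pathWeight_root, Finset.prod_mul_distrib,
      Finset.prod_const, Finset.card_univ, Fintype.card_fin]
    ring
  rw [add_comm, ← hasSum_nat_add_iff]
  simp only [hterm]
  refine (hasSum_geometric_of_abs_lt_one ?_).mul_left _
  rw [abs_pow]
  exact pow_lt_one₀ (abs_nonneg _) ha hm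

/-! ### Gauge form and density -/

/-- The point of the model with edge weights `ρ ψ v / ψ (p v)` and with the accumulated noise
cumulants `c`. -/
noncomputable def gaugePoint {n : ℕ} (p : V → V) (ρ : ℝ) (ψ : V → ℝ) (c : Order n → V → ℝ) :
    EntryIndex V n → ℝ := fun x =>
  (∏ s, ψ (x.2 s)) * (ρ ^ x.1.1) ^ familyTime p x.1.base x.2 * c x.1 (familyTop p x.1.base x.2)

theorem hasSum_sub_succ {u : ℕ → ℝ} (hu : Summable u) : HasSum (fun k => u k - u (k + 1)) (u 0) := by
  have := hu.hasSum.sub ((hasSum_nat_add_iff' 1).2 hu.hasSum)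
  simpa using this

theorem IsParentMap.hasSum_trekTerm_gauge [Finite V] (hp : IsParentMap G r p) {m : ℕ} (hm : m ≠ 0)
    {ρ : ℝ} (hρ : |ρ| < 1) {ψ : V → ℝ} (hψ : ∀ v, ψ v ≠ 0) (c : V → ℝ) (o : Fin m)
    (j : Fin m → V) :
    HasSum (trekTerm p (fun v => ρ * ψ v / ψ (p v))
        (fun t => ψ t ^ m * (c t - ρ ^ m * c (p t))) o j)
      ((∏ s, ψ (j s)) * (ρ ^ m) ^ familyTime p o j * c (familyTop p o j)) := by
  set τ := familyTime p o j with hτ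
  set u : ℕ → ℝ := fun k => (∏ s, ψ (j s)) * (ρ ^ m) ^ k * c (p^[k] (j o)) with hu
  have hρm : |ρ ^ m| < 1 := by
    rw [abs_pow]
    exact pow_lt_one₀ (abs_nonneg _) hρ hm
  have hsum : Summable u := by
    obtain ⟨C, hC⟩ := (Set.finite_range fun v => |c v|).bddAbove
    refine Summable.of_norm_bounded (g := fun k => |∏ s, ψ (j s)| * C * |ρ ^ m| ^ k)
      ((summable_geometric_of_lt_one (abs_nonneg _) hρm).mul_left _) fun k => ?_
    rw [Real.norm_eq_abs, hu, abs_mul, abs_mul, abs_pow, mul_right_comm]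
    gcongr
    exact hC ⟨_, rfl⟩
  have hsum' : Summable fun k => u (max k τ) := by
    rw [← summable_nat_add_iff τ]
    simpa using (summable_nat_add_iff τ).2 hsum
  -- Freezing `u` before time `τ` makes the differences vanish exactly where the indices have not
  -- yet met, so the whole series telescopes to `u τ`.
  convert hasSum_sub_succ hsum' using 1
  · funext k
    rw [trekTerm]
    split_ifs with h
    · have hk : τ ≤ k := (hp.familyTime_le_iff o j k).2 h
      rw [max_eq_left hk, max_eq_left (hk.trans (Nat.le_succ k))]
      simp only [pathWeight_gauge p hψ, Finset.prod_div_distrib, Finset.prod_mul_distrib, h,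
        Finset.prod_const, Finset.card_univ, Fintype.card_fin, hu, ← Function.iterate_succ_apply', ← Nat.add_one]
      have := hψ (p^[k] (j o))
      field_simp
      ring
    · have hk : k + 1 ≤ τ := by
        by_contra! hlt
        exact h ((hp.familyTime_le_iff o j k).1 (Nat.lt_succ_iff.1 hlt))
      rw [max_eq_right hk, max_eq_right ((Nat.le_succ k).trans hk), sub_self]
  · simp only [hu, zero_le, max_eq_right, familyTop, ← hτ]

/-- Any edge weights without zeros are of gauge form. -/
theorem IsParentMap.exists_gauge [Finite V] (hp : IsParentMap G r p) {a : V → ℝ}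
    (ha : ∀ v, a v ≠ 0) : ∃ ψ : V → ℝ, (∀ v, ψ v ≠ 0) ∧ a = fun v => a r * ψ v / ψ (p v) := by
  obtain ⟨L, hL⟩ := hp.exists_iterate_eq_root
  have hψ : ∀ v, pathWeight p a L v ≠ 0 := fun v => Finset.prod_ne_zero_iff.2 fun _ _ => ha _
  -- With `L` steps all vertices reach the root, so the weight of `L + 1` steps from `v` is both `a
  -- v * ψ (p v)` and `ψ v * a r`.
  refine ⟨pathWeight p a L, hψ, funext fun v => ?_⟩
  rw [eq_div_iff (hψ _), ← pathWeight_succ', pathWeight_add, hL, hp.pathWeight_root]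
  ring

/-- The recursion for the accumulated noise cumulants can be solved. -/
theorem exists_accumulated [Finite V] (p : V → V) {x : ℝ} (hx : |x| < 1)
    (w : V → ℝ) : ∃ c : V → ℝ, ∀ t, w t = c t - x * c (p t) := by
  have hsum : ∀ t, Summable fun k : ℕ => x ^ k * w (p^[k] t) := by
    obtain ⟨C, hC⟩ := (Set.finite_range fun v => |w v|).bddAbove
    intro t
    refine Summable.of_norm_bounded (g := fun k => |x| ^ k * C)
      ((summable_geometric_of_lt_one (abs_nonneg _) hx).mul_right _) fun k => ?_
    rw [Real.norm_eq_abs, abs_mul, abs_pow]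
    gcongr
    exact hC ⟨_, rfl⟩
  refine ⟨fun t => ∑' k : ℕ, x ^ k * w (p^[k] t), fun t => ?_⟩
  beta_reduce
  rw [(hsum t).tsum_eq_zero_add, ← tsum_mul_left]
  simp [pow_succ', mul_assoc]

theorem IsParentMap.gaugePoint_mem_model [Fintype V] [DecidableEq V] {n : ℕ}
    (hp : IsParentMap G r p) {ρ : ℝ} (hρ : |ρ| < 1) {ψ : V → ℝ} (hψ : ∀ v, ψ v ≠ 0)
    (c : Order n → V → ℝ) : gaugePoint p ρ ψ c ∈ model n G := by
  refine (hp.mem_model_iff _).2 ⟨fun v => ρ * ψ v / ψ (p v),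
    fun m t => ψ t ^ m.1 * (c m t - ρ ^ m.1 * c m (p t)), ?_, fun m j => ?_⟩
  · simpa [hp.root, hψ r] using hρ
  · exact hp.hasSum_trekTerm_gauge (by have := m.2.1; omega) hρ hψ (c m) m.base j

/-- Converse of `gaugePoint_mem_model` for weights without zeros: solve for `ψ` from the weights,
then for `c` from the noise divided by `ψ t ^ m`. -/
theorem IsParentMap.exists_eq_gaugePoint [Finite V] {n : ℕ} (hp : IsParentMap G r p) {a : V → ℝ}
    (ha : ∀ v, a v ≠ 0) (har : |a r| < 1) (ω : Order n → V → ℝ) {T : EntryIndex V n → ℝ}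
    (hT : ∀ (m : Order n) (j : Fin m.1 → V), HasSum (trekTerm p a (ω m) m.base j) (T ⟨m, j⟩)) :
    ∃ (ψ : V → ℝ) (c : Order n → V → ℝ), (∀ v, ψ v ≠ 0) ∧ T = gaugePoint p (a r) ψ c := by
  obtain ⟨ψ, hψ, haψ⟩ := hp.exists_gauge ha
  have hm : ∀ m : Order n, m.1 ≠ 0 := fun m => by have := m.2.1; omega
  have hc : ∀ m : Order n, ∃ c : V → ℝ, ∀ t, ω m t / ψ t ^ m.1 = c t - a r ^ m.1 * c (p t) :=
    fun m => exists_accumulated p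
      (by rw [abs_pow]; exact pow_lt_one₀ (abs_nonneg _) har (hm m)) _
  choose c hc using hc
  refine ⟨ψ, c, hψ, funext fun ⟨m, j⟩ => (hT m j).unique ?_⟩
  have h := hp.hasSum_trekTerm_gauge (hm m) har hψ (c m) m.base j
  have hω : (fun t => ψ t ^ m.1 * (c m t - a r ^ m.1 * c m (p t))) = ω m := by
    funext t
    rw [← hc, mul_div_cancel₀ _ (pow_ne_zero _ (hψ t))]
  rwa [← haψ, hω] at h

theorem continuous_trekTerm {m : ℕ} (p : V → V) (a ω : V → ℝ) (o : Fin m) (j : Fin m → V) (k : ℕ) :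
    Continuous fun ε : ℝ => trekTerm p (fun v => a v + ε) ω o j k := by
  unfold trekTerm pathWeight
  split_ifs <;> fun_prop

/-- The ideal is determined by the points of gauge form, which are dense in the model. -/
theorem IsParentMap.mem_cumulantIdeal_iff [Fintype V] [DecidableEq V] {n : ℕ}
    (hp : IsParentMap G r p) (f : MvPolynomial (EntryIndex V n) ℝ) :
    f ∈ cumulantIdeal n G ↔ ∀ (ρ : ℝ) (ψ : V → ℝ) (c : Order n → V → ℝ), |ρ| < 1 →
      (∀ v, ψ v ≠ 0) → MvPolynomial.eval (gaugePoint p ρ ψ c) f = 0 := by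
  rw [cumulantIdeal, MvPolynomial.mem_vanishingIdeal_iff]
  simp only [MvPolynomial.aeval_eq_eval]
  refine ⟨fun h ρ ψ c hρ hψ => h _ (hp.gaugePoint_mem_model hρ hψ c), fun h T hT => ?_⟩
  obtain ⟨a, ω, ha, hT⟩ := (hp.mem_model_iff T).1 hT
  obtain ⟨L, hL⟩ := hp.exists_iterate_eq_root
  have hm : ∀ m : Order n, m.1 ≠ 0 := fun m => by have := m.2.1; omega
  -- Adding a small `ε ≠ 0` to every `a v` removes all zeros and keeps `|a r + ε| < 1`. The closed
  -- form of the sums shows that the perturbed point depends continuously on `ε`.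
  set F : ℝ → EntryIndex V n → ℝ := fun ε x =>
    ∑ k ∈ Finset.range L, trekTerm p (fun v => a v + ε) (ω x.1) x.1.base x.2 k +
      ω x.1 r * (∏ s, pathWeight p (fun v => a v + ε) L (x.2 s)) * (1 - (a r + ε) ^ x.1.1)⁻¹
    with hF
  have hF0 : F 0 = T := by
    funext ⟨m, j⟩
    refine HasSum.unique ?_ (hT m j)
    simpa only [hF, add_zero] using hp.hasSum_trekTerm hL (hm m) ha (ω m) m.base j
  have hcont : ContinuousAt F 0 := by
    refine continuousAt_pi.2 fun x => ?_
    have hne : 1 - (a r + 0) ^ x.1.1 ≠ 0 := by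
      rw [add_zero, sub_ne_zero]
      intro h1
      have := pow_lt_one₀ (abs_nonneg (a r)) ha (hm x.1)
      rw [← abs_pow, ← h1, abs_one] at this
      exact lt_irrefl _ this
    refine ContinuousAt.add ?_ (ContinuousAt.mul ?_ (ContinuousAt.inv₀ ?_ hne))
    · exact (continuous_finsetSum _ fun k _ => continuous_trekTerm p a _ _ _ k).continuousAt
    · unfold pathWeight
      fun_prop
    · fun_prop
  have hev : ∀ᶠ ε in nhdsWithin (0 : ℝ) {0}ᶜ, MvPolynomial.eval (F ε) f = 0 := by
    have h1 : ∀ᶠ ε in nhdsWithin (0 : ℝ) {0}ᶜ, |a r + ε| < 1 := by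
      refine nhdsWithin_le_nhds ?_
      have : ContinuousAt (fun ε : ℝ => |a r + ε|) 0 := by fun_prop
      exact this.eventually_lt continuousAt_const (by simpa using ha)
    have h2 : ∀ᶠ ε in nhdsWithin (0 : ℝ) {0}ᶜ, ∀ v, a v + ε ≠ 0 := by
      refine Filter.eventually_all.2 fun v => ?_
      by_cases hv : a v = 0
      · filter_upwards [self_mem_nhdsWithin] with ε hε
        simpa [hv] using hε
      · refine nhdsWithin_le_nhds ?_
        have : ContinuousAt (fun ε : ℝ => a v + ε) 0 := by fun_prop
        exact this.eventually_ne (by simpa using hv)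
    filter_upwards [h1, h2] with ε h1 h2
    obtain ⟨ψ, c, hψ, hψc⟩ := hp.exists_eq_gaugePoint (a := fun v => a v + ε) h2 h1 ω (T := F ε)
      fun m j => hp.hasSum_trekTerm hL (hm m) h1 (ω m) m.base j
    rw [hψc]
    exact h _ ψ c h1 hψ
  have hlim : Filter.Tendsto (fun ε => MvPolynomial.eval (F ε) f) (nhdsWithin 0 {0}ᶜ)
      (nhds (MvPolynomial.eval (F 0) f)) :=
    (((MvPolynomial.continuous_eval f).continuousAt.comp hcont).tendsto).mono_left
      nhdsWithin_le_nhds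
  rw [← hF0]
  exact tendsto_nhds_unique hlim
    (tendsto_const_nhds.congr' (hev.mono fun _ h => h.symm))

theorem gaugePoint_congr {n : ℕ} {q : V → V} (ht : ∀ i j, pairTime p i j = pairTime q i j)
    (h : ∀ i j, pairTop p i j = pairTop q i j) (ρ : ℝ) (ψ : V → ℝ) (c : Order n → V → ℝ) :
    gaugePoint p ρ ψ c = gaugePoint q ρ ψ c := by
  funext x
  rw [gaugePoint, gaugePoint, familyTop_congr ht h]
  simp only [familyTime, ht]

end Model


/-! ### Polynomials that recover the tops and the levels -/

section Recovery

variable {V : Type*} {n : ℕ}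

/-- The order two, as an element of `Order n`. -/
def orderTwo (hn : 3 ≤ n) : Order n := ⟨2, le_rfl, by omega⟩

/-- The order three, as an element of `Order n`. -/
def orderThree (hn : 3 ≤ n) : Order n := ⟨3, by omega, hn⟩

/-- The entry of the covariance matrix at `(i, j)`. -/
noncomputable def covariance (hn : 3 ≤ n) (i j : V) : MvPolynomial (EntryIndex V n) ℝ :=
  MvPolynomial.X ⟨orderTwo hn, ![i, j]⟩

/-- The entry of the third cumulant tensor at `(i, j, k)`. -/
noncomputable def thirdCumulant (hn : 3 ≤ n) (i j k : V) : MvPolynomial (EntryIndex V n) ℝ :=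
  MvPolynomial.X ⟨orderThree hn, ![i, j, k]⟩

/-- The binomial that expresses the equality of the tops of the pairs `(i, j)` and `(t, t)`. -/
noncomputable def topBinomial (hn : 3 ≤ n) (i j t : V) : MvPolynomial (EntryIndex V n) ℝ :=
  thirdCumulant hn i i j * thirdCumulant hn i j j * covariance hn t t ^ 3 -
    thirdCumulant hn t t t ^ 2 * covariance hn i j ^ 3

/-- The binomial that expresses that the levels of `i` and `j` are in proportion `x : y`. -/
noncomputable def levelBinomial (hn : 3 ≤ n) (r i j : V) (x y : ℕ) :
    MvPolynomial (EntryIndex V n) ℝ :=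
  (thirdCumulant hn i r r * covariance hn r r) ^ y *
      (thirdCumulant hn r r r * covariance hn j r) ^ x -
    (thirdCumulant hn j r r * covariance hn r r) ^ x *
      (thirdCumulant hn r r r * covariance hn i r) ^ y

variable {G H : Digraph V} {r s : V} {p q : V → V}

theorem IsParentMap.eval_covariance (hp : IsParentMap G r p) (hn : 3 ≤ n) (ρ : ℝ) (ψ : V → ℝ)
    (c : Order n → V → ℝ) (i j : V) :
    MvPolynomial.eval (gaugePoint p ρ ψ c) (covariance hn i j) =
      ψ i * ψ j * (ρ ^ 2) ^ pairTime p i j * c (orderTwo hn) (pairTop p i j) := by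
  have ht : familyTime p (0 : Fin 2) ![i, j] = pairTime p i j := by
    refine eq_of_forall_ge_iff fun k => ?_
    rw [hp.familyTime_le_iff, hp.pairTime_le_iff]
    refine (Fin.forall_fin_two (p := fun s => p^[k] (![i, j] s) = p^[k] i)).trans ?_
    simp [eq_comm]
  have hprod : ∏ s, ψ ((![i, j] : Fin 2 → V) s) = ψ i * ψ j := by simp [Fin.prod_univ_two]
  rw [covariance, MvPolynomial.eval_X, pairTop, ← ht, ← hprod]
  rfl

/-- A repeated index reduces the triple to the pair `(i, k)`, so its time and top are those of the
pair. -/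
theorem IsParentMap.eval_thirdCumulant (hp : IsParentMap G r p) (hn : 3 ≤ n) (ρ : ℝ) (ψ : V → ℝ)
    (c : Order n → V → ℝ) (i j k : V) (h : j = i ∨ k = j) :
    MvPolynomial.eval (gaugePoint p ρ ψ c) (thirdCumulant hn i j k) =
      ψ i * ψ j * ψ k * (ρ ^ 3) ^ pairTime p i k * c (orderThree hn) (pairTop p i k) := by
  have ht : familyTime p (0 : Fin 3) ![i, j, k] = pairTime p i k := by
    refine eq_of_forall_ge_iff fun l => ?_
    rw [hp.familyTime_le_iff, hp.pairTime_le_iff]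
    refine (Fin.forall_fin_succ (P := fun s => p^[l] (![i, j, k] s) = p^[l] i)).trans ?_
    simp only [Fin.forall_fin_two]
    rcases h with rfl | rfl <;> simp [eq_comm]
  have hprod : ∏ s, ψ ((![i, j, k] : Fin 3 → V) s) = ψ i * ψ j * ψ k := by
    simp [Fin.prod_univ_three]
  rw [thirdCumulant, MvPolynomial.eval_X, pairTop, ← ht, ← hprod]
  rfl

/-! ### Root, tops and depths from the ideal -/

theorem IsParentMap.root_eq (hp : IsParentMap G r p) (hq : IsParentMap H s q)
    (h : ∀ i j, pairTop p i j = pairTop q i j) : r = s := by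
  rw [← hp.root_pairTop s, h, hq.pairTop_root]

theorem IsParentMap.exists_depth_eq_one (hp : IsParentMap G r p) {i : V} (hi : depth p r i ≠ 0) :
    ∃ j, depth p r j = 1 :=
  ⟨p^[depth p r i - 1] i, by rw [hp.depth_iterate]; omega⟩

variable [Fintype V] [DecidableEq V]

/-- Both terms carry `(ψ i * ψ j) ^ 3 * ψ t ^ 6` and `ρ ^ (6 * τ)`. What remains is `c₃ (top) ^ 2 *
c₂ t ^ 3 - c₃ t ^ 2 * c₂ (top) ^ 3`. -/
theorem IsParentMap.topBinomial_mem_iff (hp : IsParentMap G r p) (hn : 3 ≤ n) (i j t : V) :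
    topBinomial hn i j t ∈ cumulantIdeal n G ↔ pairTop p i j = t := by
  rw [hp.mem_cumulantIdeal_iff]
  simp only [topBinomial, map_sub, map_mul, map_pow, hp.eval_covariance,
    hp.eval_thirdCumulant hn _ _ _ i i j (Or.inl rfl),
    hp.eval_thirdCumulant hn _ _ _ i j j (Or.inr rfl),
    hp.eval_thirdCumulant hn _ _ _ t t t (Or.inl rfl), hp.pairTime_self, hp.pairTop_self]
  constructor
  · intro h
    by_contra hne
    -- With `c₂ = 1` and `c₃` the indicator of `t`, only the second term survives when the top is
    -- not `t`.
    have := h (1 / 2) (fun _ => 1)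
      (fun m v => if m = orderTwo hn then 1 else if v = t then 1 else 0)
      (by norm_num [abs_lt]) fun _ => one_ne_zero
    have h32 : orderThree hn ≠ orderTwo hn := fun h => by
      simpa [orderThree, orderTwo] using congrArg Subtype.val h
    simp [h32, hne] at this
  · rintro rfl ρ ψ c - -
    ring

/-- The quotient of `T_irr * T_rr` by `T_rrr * T_ir` is `ρ ^ depth i`, since `3 - 2 = 1`. The
binomial is the cleared form of equating its `y`-th power for `i` with its `x`-th power for `j`. -/
theorem IsParentMap.levelBinomial_mem_iff (hp : IsParentMap G r p) (hn : 3 ≤ n) (i j : V)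
    (x y : ℕ) :
    levelBinomial hn r i j x y ∈ cumulantIdeal n G ↔ depth p r i * y = depth p r j * x := by
  rw [hp.mem_cumulantIdeal_iff]
  simp only [levelBinomial, map_sub, map_mul, map_pow, hp.eval_covariance,
    hp.eval_thirdCumulant hn _ _ _ _ r r (Or.inr rfl), hp.pairTime_root, hp.pairTop_root,
    hp.depth_root, pow_zero, mul_one]
  constructor
  · intro h
    have h1 := h (1 / 2) (fun _ => 1) (fun _ _ => 1) (by norm_num [abs_lt]) fun _ => one_ne_zero
    simp only [one_mul, mul_one, ← pow_mul, sub_eq_zero, ← pow_add] at h1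
    have h2 := pow_right_injective₀ (a := (1 / 2 : ℝ)) (by norm_num) (by norm_num) h1
    ring_nf at h2
    linarith
  · intro h ρ ψ c _ _
    have h2 : (ρ ^ 3) ^ depth p r i = (ρ ^ 2) ^ depth p r i * ρ ^ depth p r i := by ring
    have h3 : (ρ ^ 3) ^ depth p r j = (ρ ^ 2) ^ depth p r j * ρ ^ depth p r j := by ring
    have h4 : (ρ ^ depth p r i) ^ y = (ρ ^ depth p r j) ^ x := by rw [← pow_mul, ← pow_mul, h]
    rw [h2, h3]
    simp only [mul_pow, h4]
    ring

theorem IsParentMap.pairTop_eq_of_cumulantIdeal_eq (hp : IsParentMap G r p)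
    (hq : IsParentMap H s q) (hn : 3 ≤ n) (h : cumulantIdeal n G = cumulantIdeal n H) (i j : V) :
    pairTop p i j = pairTop q i j :=
  ((hq.topBinomial_mem_iff hn i j _).1 (h ▸ (hp.topBinomial_mem_iff hn i j _).2 rfl)).symm

/-- The two depth functions are proportional. Each takes the value one unless the vertex is the
root, and a product of naturals equal to one forces the factor to be one. -/
theorem IsParentMap.depth_eq_of_cumulantIdeal_eq (hp : IsParentMap G r p)
    (hq : IsParentMap H r q) (hn : 3 ≤ n) (h : cumulantIdeal n G = cumulantIdeal n H) (i : V) :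
    depth p r i = depth q r i := by
  have key : ∀ i j, depth q r i * depth p r j = depth q r j * depth p r i := fun i j =>
    (hq.levelBinomial_mem_iff hn i j _ _).1
      (h ▸ (hp.levelBinomial_mem_iff hn i j _ _).2 (mul_comm _ _))
  have hroot : ∀ v, depth p r v = 0 ↔ depth q r v = 0 := fun v => by
    rw [← Nat.le_zero, hp.depth_le_iff, ← Nat.le_zero, hq.depth_le_iff]; rfl
  by_cases hi : depth p r i = 0
  · rw [hi, (hroot i).1 hi]
  · obtain ⟨j, hj⟩ := hp.exists_depth_eq_one hi
    obtain ⟨k, hk⟩ := hq.exists_depth_eq_one fun h0 => hi ((hroot i).2 h0)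
    have h1 : depth q r j = 1 := by
      have := key k j
      rw [hk, hj] at this
      exact Nat.eq_one_of_mul_eq_one_right this.symm
    have := key i j
    rw [hj, h1] at this
    omega

theorem IsParentMap.cumulantIdeal_eq_iff (hp : IsParentMap G r p) (hq : IsParentMap H s q)
    (hn : 3 ≤ n) : cumulantIdeal n G = cumulantIdeal n H ↔
      (∀ v, depth p r v = depth q s v) ∧ ∀ i j, pairTop p i j = pairTop q i j := by
  constructor
  · intro h
    have htop := hp.pairTop_eq_of_cumulantIdeal_eq hq hn h
    obtain rfl := hp.root_eq hq htop
    exact ⟨hp.depth_eq_of_cumulantIdeal_eq hq hn h, htop⟩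
  · rintro ⟨hdepth, htop⟩
    have ht : ∀ i j, pairTime p i j = pairTime q i j := fun i j => by
      rw [hp.pairTime_eq, hq.pairTime_eq, hdepth, hdepth, htop, hdepth]
    ext f
    rw [hp.mem_cumulantIdeal_iff, hq.mem_cumulantIdeal_iff]
    simp only [gaugePoint_congr ht htop]

end Recovery

end DiscreteLyapunov

theorem mainTheorem6 {V : Type*} [Fintype V] [DecidableEq V] (n : ℕ) (hn : 3 ≤ n)
    (G H : Digraph V) (rG rH : V)
    (hG : DiscreteLyapunov.IsDirectedTree G rG) (hH : DiscreteLyapunov.IsDirectedTree H rH) :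
    DiscreteLyapunov.cumulantIdeal n G = DiscreteLyapunov.cumulantIdeal n H ↔
      (∀ l : ℕ, DiscreteLyapunov.levelSet G rG l = DiscreteLyapunov.levelSet H rH l) ∧
      (∀ i j t : V, DiscreteLyapunov.IsTopOfShortestEquitrek G i j t ↔
        DiscreteLyapunov.IsTopOfShortestEquitrek H i j t) := by
  obtain ⟨p, hp⟩ := hG.exists_isParentMap
  obtain ⟨q, hq⟩ := hH.exists_isParentMap
  rw [hp.levelSet_eq_iff hq, hp.top_eq_iff hq, hp.cumulantIdeal_eq_iff hq hn]
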